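/- Let $S_\infty$ be the group of all permutations of $\mathbb{N}$ with the topology of pointwise convergence ($\mathbb{N}$ being discrete), and let $\mathcal{F}(S_\infty)$ be the set of all closed subsets of $S_\infty$, equipped with the Effros Borel structure, i.e. the $\sigma$-algebra generated by the sets $\{F\in\mathcal{F}(S_\infty) : F\cap N_{\bar a,\bar b}\neq\emptyset\}$, where $N_{\bar a,\bar b}=\{g\in S_\infty : g(\bar a)=\bar b\}$ and $\bar a,\bar b$ range over the pairs of finite tuples of natural numbers of the same length. A topological group $G$ is extremely amenable if every continuous action of $G$ on a nonempty compact Hausdorff space has a fixed point. Let $\mathsf{EA}$ be the class of those closed subgroups of $S_\infty$ which, with the subspace topology, are extremely amenable. Then $\mathsf{EA}$ is a Borel subset of $\mathcal{F}(S_\infty)$, that is, it belongs to this $\sigma$-algebra. -/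

import Mathlib

open TopologicalSpace

universe u v

/-- A topological group `G` is *extremely amenable* if every `G`-flow, i.e. every continuous action
of `G` on a nonempty compact Hausdorff space `X`, has a fixed point. -/
def ExtremelyAmenable (G : Type v) [Group G] [TopologicalSpace G] [IsTopologicalGroup G] : Prop :=
  ∀ (X : Type u) [TopologicalSpace X] [CompactSpace X] [T2Space X] [Nonempty X]
    [MulAction G X] [ContinuousSMul G X], ∃ x : X, ∀ g : G, g • x = x

/-- `S_∞`, the group of all permutations of `ℕ` (with composition). -/
abbrev SInfty : Type := Equiv.Perm ℕ

namespace SInfty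

/-- The topology of pointwise convergence: the subspace topology inherited from the product
`ℕ → ℕ` of discrete spaces. -/
instance instTopologicalSpace : TopologicalSpace SInfty :=
  TopologicalSpace.induced (fun g : SInfty => (g : ℕ → ℕ)) inferInstance

theorem continuous_eval (a : ℕ) : Continuous fun g : SInfty => g a :=
  (continuous_apply a).comp continuous_induced_dom

theorem isOpen_eval (a b : ℕ) : IsOpen {g : SInfty | g a = b} :=
  (isOpen_discrete {b}).preimage (continuous_eval a)

theorem continuous_of_eval {Y : Type*} [TopologicalSpace Y] {f : Y → SInfty}
    (h : ∀ a, Continuous fun y => f y a) : Continuous f :=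
  continuous_induced_rng.2 (continuous_pi h)

instance instIsTopologicalGroup : IsTopologicalGroup SInfty where
  continuous_mul := by
    refine continuous_of_eval fun a => continuous_discrete_rng.2 fun b => ?_
    have h : (fun p : SInfty × SInfty => (p.1 * p.2) a) ⁻¹' {b} =
        ⋃ c, {p : SInfty × SInfty | p.2 a = c} ∩ {p : SInfty × SInfty | p.1 c = b} := by
      ext p
      simp
    rw [h]
    exact isOpen_iUnion fun c => ((isOpen_eval a c).preimage continuous_snd).inter
      ((isOpen_eval c b).preimage continuous_fst)
  continuous_inv := by
    refine continuous_of_eval fun a => continuous_discrete_rng.2 fun b => ?_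
    have h : (fun g : SInfty => g⁻¹ a) ⁻¹' {b} = {g : SInfty | g b = a} := by
      ext g
      exact Equiv.Perm.inv_eq_iff_eq.trans eq_comm
    rw [h]
    exact isOpen_eval b a

/-- The basic open set `N_{a,b} = {g | g(a) = b}` for tuples `a, b` of the same length. -/
def basicOpen {n : ℕ} (a b : Fin n → ℕ) : Set SInfty := {g | ∀ i, g (a i) = b i}

/-- The Effros Borel structure on the space `F(S_∞)` of all closed subsets of `S_∞`: the σ-algebra
generated by the sets `{F | F ∩ N_{a,b} ≠ ∅}`. -/
instance effros : MeasurableSpace (Closeds SInfty) :=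
  MeasurableSpace.generateFrom
    {S | ∃ (n : ℕ) (a b : Fin n → ℕ),
      S = {F : Closeds SInfty | ((F : Set SInfty) ∩ basicOpen a b).Nonempty}}

end SInfty

/-- The class `EA` of extremely amenable closed subgroups of `S_∞` (each with the subspace
topology), as a subset of the space of closed subsets of `S_∞`. The parameter `u` is the universe
of the flows. -/
def EA : Set (Closeds SInfty) :=
  {F | ∃ G : Subgroup SInfty, (G : Set SInfty) = F ∧ ExtremelyAmenable.{u} G}

/-! Following Kechris, Pestov and Todorcevic, extreme amenability of a subgroup is equivalent to a
finite Ramsey property of its orbits on tuples (`extremelyAmenable_iff_ramsey`). Compactness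
supplies a finite `B` that works for all colourings, so colourings range over finite sets. The
property then has only countable quantifiers and sees `F` only through the basic open sets it meets,
hence is Borel; so is being a subgroup. -/

open Filter Topology Uniformity

/-! ### Fixed points and the Ramsey property -/

namespace ExtremelyAmenable

/-- Extreme amenability implies the finite Ramsey property for actions on discrete sets. -/
theorem exists_finset_monochromatic {G : Type v} [Group G] [TopologicalSpace G]
    [IsTopologicalGroup G] (hG : ExtremelyAmenable.{u} G) {T : Type} [TopologicalSpace T]
    [DiscreteTopology T] [MulAction G T] [ContinuousSMul G T] (K : Type u) [Finite K]
    (A : Finset T) (hA : ∀ x ∈ A, ∀ y ∈ A, ∃ g : G, g • x = y) :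
    ∃ B : Finset T, ∀ c : T → K, ∃ g : G, (∀ x ∈ A, g • x ∈ B) ∧
      ∀ x ∈ A, ∀ y ∈ A, c (g • x) = c (g • y) := by
  classical
  by_contra! hbad
  let _ : TopologicalSpace K := ⊥
  have : DiscreteTopology K := ⟨rfl⟩
  have : CompactSpace K := Finite.compactSpace
  let _ : MulAction G (T → K) := arrowAction
  have smul_def : ∀ (g : G) (c : T → K) (t : T), (g • c) t = c (g⁻¹ • t) := fun _ _ _ => rfl
  let C : Finset T → Set (T → K) := fun B =>
    {c | ∀ g : G, (∀ x ∈ A, g • x ∈ B) → ∃ x ∈ A, ∃ y ∈ A, c (g • x) ≠ c (g • y)}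
  have hC : ∀ B, IsClosed (C B) := by
    intro B
    have : C B = ⋂ (g : G) (_ : ∀ x ∈ A, g • x ∈ B), ⋃ x ∈ A, ⋃ y ∈ A,
        {c : T → K | c (g • x) ≠ c (g • y)} := by
      ext c
      simp [C]
    rw [this]
    refine isClosed_iInter fun g => isClosed_iInter fun _ => ?_
    refine A.finite_toSet.isClosed_biUnion fun x _ =>
      A.finite_toSet.isClosed_biUnion fun y _ => ?_
    have hcont : Continuous fun c : T → K => (c (g • x), c (g • y)) := by fun_prop
    exact (isClosed_discrete {p : K × K | p.1 ≠ p.2}).preimage hcont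
  have hne : (⋂ B, C B).Nonempty := by
    refine IsCompact.nonempty_iInter_of_directed_nonempty_isCompact_isClosed C ?_ ?_
      (fun B => (hC B).isCompact) hC
    · intro B₁ B₂
      refine ⟨B₁ ∪ B₂, fun c hc g hg => hc g fun x hx => ?_, fun c hc g hg => hc g fun x hx => ?_⟩
      · exact Finset.mem_union_left _ (hg x hx)
      · exact Finset.mem_union_right _ (hg x hx)
    · intro B
      obtain ⟨c, hc⟩ := hbad B
      exact ⟨c, hc⟩
  -- The colourings with no monochromatic translate of `A` form a subflow, nonempty by compactness.
  -- A fixed point in it is constant on orbits, but `A` lies in one orbit.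
  let X : Set (T → K) := {c | ∀ g : G, ∃ x ∈ A, ∃ y ∈ A, c (g • x) ≠ c (g • y)}
  have hX : X = ⋂ B, C B := by
    ext c
    simp only [Set.mem_iInter]
    exact ⟨fun h B g _ => h g, fun h g =>
      h (A.image (g • ·)) g fun x hx => Finset.mem_image_of_mem _ hx⟩
  have hXne : Nonempty X := by rw [hX]; exact hne.to_subtype
  have hXc : CompactSpace X := by
    rw [← isCompact_iff_compactSpace, hX]
    exact (isClosed_iInter hC).isCompact
  have hinv : ∀ (h : G) (c : T → K), c ∈ X → h • c ∈ X := by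
    intro h c hc g
    obtain ⟨x, hx, y, hy, hxy⟩ := hc (h⁻¹ * g)
    refine ⟨x, hx, y, hy, ?_⟩
    simpa only [smul_def, ← mul_smul] using hxy
  let _ : MulAction G X :=
    { smul := fun g c => ⟨g • c.1, hinv g c.1 c.2⟩
      one_smul := fun c => Subtype.ext (one_smul G c.1)
      mul_smul := fun g h c => Subtype.ext (mul_smul g h c.1) }
  have : ContinuousSMul G X := by
    refine ⟨continuous_induced_rng.2 (continuous_pi fun t => ?_)⟩
    have hev : Continuous fun p : (T → K) × T => p.1 p.2 :=
      continuous_prod_of_discrete_right.2 fun t => continuous_apply t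
    exact hev.comp ((continuous_subtype_val.comp continuous_snd).prodMk
      (continuous_fst.inv.smul continuous_const))
  obtain ⟨c, hc⟩ := hG X
  obtain ⟨x, hx, y, hy, hxy⟩ := c.2 1
  obtain ⟨g, rfl⟩ := hA x hx y hy
  refine hxy ?_
  have := congrFun (congrArg Subtype.val (hc g)) (g • x)
  change c.1 (g⁻¹ • g • x) = c.1 (g • x) at this
  simpa using this

/-- A group is extremely amenable if the stabilizers of points satisfying the finite Ramsey
property form a neighbourhood basis of the identity. -/
theorem of_monochromatic {G : Type v} [Group G] [TopologicalSpace G] [IsTopologicalGroup G]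
    (h : ∀ U ∈ 𝓝 (1 : G), ∃ (T : Type) (_ : MulAction G T) (a : T),
      (∀ g : G, g • a = a → g ∈ U) ∧
      ∀ (k : ℕ) (A : Finset T), (∀ x ∈ A, ∃ g : G, g • a = x) → ∀ c : T → Fin k,
        ∃ g : G, ∀ x ∈ A, ∀ y ∈ A, c (g • x) = c (g • y)) :
    ExtremelyAmenable.{u} G := by
  classical
  intro X _ _ _ _ _ _
  let _ : UniformSpace X := uniformSpaceOfCompactR1
  have almost : ∀ (F : Finset G), ∀ E ∈ 𝓤 X, ∃ x : X, ∀ g ∈ F, (x, g • x) ∈ E := by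
    intro F E hE
    obtain ⟨E₁, hE₁, hs₁, hE₁E⟩ := comp_symm_mem_uniformity_sets hE
    obtain ⟨D, hD, hs, hDE⟩ := comp_symm_mem_uniformity_sets hE₁
    have hU : ∀ᶠ g in 𝓝 (1 : G), ∀ y : X, (g • y, y) ∈ D := by
      have := isCompact_univ.eventually_forall_of_forall_eventually (K := (Set.univ : Set X))
        (x₀ := (1 : G)) (P := fun (g : G) (y : X) => (g • y, y) ∈ D) fun y _ => ?_
      · simpa using this
      · have hcont : Continuous fun p : G × X => (p.1 • p.2, p.2) := by fun_prop
        refine hcont.continuousAt (x := ((1 : G), y)) ?_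
        simpa only [one_smul] using nhds_le_uniformity y hD
    obtain ⟨T, _, a, ha, hR⟩ := h _ hU
    obtain ⟨t, -, ht⟩ := isCompact_univ.elim_finite_subcover_image (b := (Set.univ : Set X))
      (c := fun x => interior {y | (y, x) ∈ D}) (fun _ _ => isOpen_interior) (fun y _ => by
        refine Set.mem_iUnion₂.2 ⟨y, trivial, mem_interior_iff_mem_nhds.2 (mem_nhds_right y hD)⟩)
    obtain ⟨htf, ht⟩ := ht
    have hcov : ∀ y : X, ∃ x : t, (y, x.1) ∈ D := by
      intro y
      obtain ⟨x, hx, hy⟩ := Set.mem_iUnion₂.1 (ht (Set.mem_univ y))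
      exact ⟨⟨x, hx⟩, interior_subset (s := {y | (y, x) ∈ D}) hy⟩
    choose p hp using hcov
    have : Finite t := htf
    obtain ⟨k, ⟨e⟩⟩ := Finite.exists_equiv_fin t
    obtain ⟨x₀⟩ := ‹Nonempty X›
    -- `r` picks a representative of each coset of the stabilizer of `a`; `z` is coloured by a piece
    -- of a `D`-small cover near `(r z)⁻¹ • x₀`.
    let r : T → G := fun z => if hz : ∃ g : G, g • a = z then hz.choose else 1
    have hr : ∀ g : G, r (g • a) • a = g • a := by
      intro g
      have hz : ∃ g' : G, g' • a = g • a := ⟨g, rfl⟩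
      simp only [r, dif_pos hz]
      exact hz.choose_spec
    have hclose : ∀ g : G, ((r (g • a))⁻¹ • x₀, g⁻¹ • x₀) ∈ D := by
      intro g
      have := ha ((r (g • a))⁻¹ * g) (by rw [mul_smul, inv_smul_eq_iff, hr g])
      simpa [mul_smul] using this (g⁻¹ • x₀)
    -- Equal colours at `g • a` and `(g * f⁻¹) • a` make `g⁻¹ • x₀` close to `f • g⁻¹ • x₀`.
    obtain ⟨g, hg⟩ := hR k (insert a (F.image fun f => f⁻¹ • a))
      (by
        intro x hx
        rcases Finset.mem_insert.1 hx with rfl | hx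
        · exact ⟨1, one_smul _ _⟩
        · obtain ⟨f, -, rfl⟩ := Finset.mem_image.1 hx
          exact ⟨f⁻¹, rfl⟩)
      (fun z => e (p ((r z)⁻¹ • x₀)))
    refine ⟨g⁻¹ • x₀, fun f hf => hE₁E ?_⟩
    have hcol := e.injective (hg a (Finset.mem_insert_self _ _) (f⁻¹ • a)
      (Finset.mem_insert_of_mem (Finset.mem_image_of_mem _ hf)))
    rw [← mul_smul] at hcol
    have h₁ := hclose g
    have h₂ := hclose (g * f⁻¹)
    rw [mul_inv_rev, inv_inv, mul_smul f] at h₂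
    have h₃ := hp ((r (g • a))⁻¹ • x₀)
    have h₄ := hp ((r ((g * f⁻¹) • a))⁻¹ • x₀)
    rw [← hcol] at h₄
    refine ⟨(p ((r (g • a))⁻¹ • x₀)).1, hDE ⟨_, ?_, h₃⟩, hDE ⟨_, ?_, h₂⟩⟩
    · exact hs.symm _ _ h₁
    · exact hs.symm _ _ h₄
  obtain ⟨x, hx⟩ : (⋂ i : G × {E : Set (X × X) // E ∈ 𝓤 X ∧ IsClosed E},
      {x : X | (x, i.1 • x) ∈ i.2.1}).Nonempty := by
    refine CompactSpace.iInter_nonempty (fun i => ?_) fun s => ?_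
    · exact i.2.2.2.preimage (by fun_prop : Continuous fun x : X => (x, i.1 • x))
    · obtain ⟨x, hx⟩ := almost (s.image Prod.fst) (⋂ i ∈ s, i.2.1)
        ((biInter_finset_mem s).2 fun i _ => i.2.2.1)
      refine ⟨x, Set.mem_iInter₂.2 fun i hi => ?_⟩
      exact Set.mem_iInter₂.1 (hx i.1 (Finset.mem_image_of_mem _ hi)) i hi
  refine ⟨x, fun g => ?_⟩
  refine (eq_of_uniformity_basis uniformity_hasBasis_closed fun {E} hE => ?_).symm
  exact Set.mem_iInter.1 hx (g, ⟨E, hE⟩)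

end ExtremelyAmenable

/-! ### Borel coding by basic open sets -/

namespace SInfty

theorem exists_forall_lt_imp_mem {U : Set SInfty} {g : SInfty} (hU : U ∈ 𝓝 g) :
    ∃ n : ℕ, ∀ h : SInfty, (∀ i : Fin n, h i = g i) → h ∈ U := by
  rw [nhds_induced, mem_comap] at hU
  obtain ⟨V, hV, hVU⟩ := hU
  rw [nhds_pi, mem_pi] at hV
  obtain ⟨I, hI, t, ht, htV⟩ := hV
  obtain ⟨m, hm⟩ := hI.bddAbove
  refine ⟨m + 1, fun h hh => hVU (htV fun i hi => ?_)⟩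
  have : h i = g i := hh ⟨i, Nat.lt_succ_of_le (hm hi)⟩
  change h i ∈ t i
  exact this ▸ mem_of_mem_nhds (ht i)

instance : ContinuousSMul SInfty ℕ where
  continuous_smul := continuous_prod_of_discrete_right.2 continuous_eval

/-- The predicate that some element of `F` maps the family `a` to the family `b`. -/
def Hits (F : Set SInfty) {ι : Type} (a b : ι → ℕ) : Prop :=
  ∃ g ∈ F, ∀ i, g (a i) = b i

theorem measurable_hits {ι : Type} [Finite ι] (a b : ι → ℕ) :
    Measurable fun F : Closeds SInfty => Hits (F : Set SInfty) a b := by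
  obtain ⟨n, ⟨e⟩⟩ := Finite.exists_equiv_fin ι
  refine measurableSet_setOfPred.1 (MeasurableSpace.measurableSet_generateFrom
    ⟨n, a ∘ e.symm, b ∘ e.symm, ?_⟩)
  ext F
  refine exists_congr fun g => and_congr_right fun _ => ?_
  exact (e.symm.forall_congr_right (q := fun i => g (a i) = b i)).symm

/-- Closedness enters here: `g` is a limit of elements of `F` agreeing with it on initial segments.
-/
theorem mem_of_forall_hits (F : Closeds SInfty) (g : SInfty)
    (h : ∀ (n : ℕ) (a : Fin n → ℕ), Hits (F : Set SInfty) a (g ∘ a)) : g ∈ F := by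
  refine F.isClosed.closure_subset (mem_closure_iff_nhds.2 fun U hU => ?_)
  obtain ⟨n, hn⟩ := exists_forall_lt_imp_mem hU
  obtain ⟨f, hf, hfg⟩ := h n fun i => i
  exact ⟨f, hn f hfg, hf⟩

/-- The closure properties of a subgroup, expressed by the basic open sets that it meets. -/
def IsSubgroupLike (F : Set SInfty) : Prop :=
  (∀ (n : ℕ) (a : Fin n → ℕ), Hits F a a) ∧
  (∀ (n : ℕ) (a b : Fin n → ℕ), Hits F a b → Hits F b a) ∧
  ∀ (n : ℕ) (a b c : Fin n → ℕ), Hits F a b → Hits F b c → Hits F a c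

theorem isSubgroupLike_iff (F : Closeds SInfty) :
    IsSubgroupLike F ↔ ∃ G : Subgroup SInfty, (G : Set SInfty) = F := by
  constructor
  · rintro ⟨h₁, hi, hm⟩
    refine ⟨⟨⟨⟨F, ?_⟩, ?_⟩, ?_⟩, rfl⟩
    · intro g h hg hh
      exact mem_of_forall_hits F _ fun n a =>
        hm n a (h ∘ a) _ ⟨h, hh, fun _ => rfl⟩ ⟨g, hg, fun _ => rfl⟩
    · exact mem_of_forall_hits F _ h₁
    · intro g hg
      exact mem_of_forall_hits F _ fun n a => hi n _ a ⟨g, hg, fun i => g.apply_symm_apply (a i)⟩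
  · rintro ⟨G, hG⟩
    rw [← hG]
    refine ⟨fun n a => ⟨1, G.one_mem, fun _ => rfl⟩, ?_, ?_⟩
    · rintro n a b ⟨g, hg, hab⟩
      exact ⟨g⁻¹, G.inv_mem hg, fun i => Equiv.Perm.inv_eq_iff_eq.2 (hab i).symm⟩
    · rintro n a b c ⟨g, hg, hab⟩ ⟨h, hh, hbc⟩
      refine ⟨h * g, G.mul_mem hh hg, fun i => ?_⟩
      rw [Equiv.Perm.mul_apply, hab, hbc]

/-- The finite Ramsey property for the orbits of `F` on tuples. -/
def Ramsey (F : Set SInfty) : Prop :=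
  ∀ (n k : ℕ) (A : Finset (Fin n → ℕ)), (∀ x ∈ A, ∀ y ∈ A, Hits F x y) →
    ∃ B : Finset (Fin n → ℕ), ∀ c : B → Fin (k + 1), ∃ φ : A → B,
      (∀ x y, c (φ x) = c (φ y)) ∧
        Hits F (fun p : A × Fin n => p.1.1 p.2) fun p => (φ p.1).1 p.2

theorem measurable_isSubgroupLike :
    Measurable fun F : Closeds SInfty => IsSubgroupLike (F : Set SInfty) := by
  refine .and (.forall fun n => .forall fun a => measurable_hits a a) (.and ?_ ?_)
  · exact .forall fun n => .forall fun a => .forall fun b =>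
      (measurable_hits a b).imp (measurable_hits b a)
  · exact .forall fun n => .forall fun a => .forall fun b => .forall fun c =>
      (measurable_hits a b).imp ((measurable_hits b c).imp (measurable_hits a c))

theorem measurable_ramsey : Measurable fun F : Closeds SInfty => Ramsey (F : Set SInfty) := by
  refine .forall fun n => .forall fun k => .forall fun A => .imp ?_ ?_
  · exact .forall fun x => .imp measurable_const <| .forall fun y => .imp measurable_const <|
      measurable_hits x y
  · exact .exists fun B => .forall fun c => .exists fun φ => .and measurable_const <|
      measurable_hits _ _

theorem extremelyAmenable_iff_ramsey (G : Subgroup SInfty) :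
    ExtremelyAmenable.{u} G ↔ Ramsey (G : Set SInfty) := by
  classical
  constructor
  · intro hG n k A hA
    obtain ⟨B, hB⟩ := hG.exists_finset_monochromatic (T := Fin n → ℕ) (ULift.{u} (Fin (k + 1))) A
      fun x hx y hy => by
        obtain ⟨g, hg, hxy⟩ := hA x hx y hy
        exact ⟨⟨g, hg⟩, funext hxy⟩
    refine ⟨B, fun c => ?_⟩
    -- Having `k + 1` colours leaves a default colour outside `B`.
    obtain ⟨g, hgB, hg⟩ := hB fun t => ⟨if ht : t ∈ B then c ⟨t, ht⟩ else 0⟩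
    refine ⟨fun x => ⟨g • x.1, hgB _ x.2⟩, fun x y => ?_, g, g.2, fun _ => rfl⟩
    have := congrArg ULift.down (hg x x.2 y y.2)
    simpa only [dif_pos (hgB _ x.2), dif_pos (hgB _ y.2)] using this
  · intro hR
    refine ExtremelyAmenable.of_monochromatic fun U hU => ?_
    rw [nhds_induced, mem_comap] at hU
    obtain ⟨V, hV, hVU⟩ := hU
    obtain ⟨n, hn⟩ := exists_forall_lt_imp_mem hV
    refine ⟨Fin n → ℕ, inferInstance, fun i => i, fun g hg => hVU (hn g (congrFun hg)), ?_⟩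
    intro k A hA c
    obtain _ | k := k
    · exact (c 0).elim0
    obtain ⟨B, hB⟩ := hR n k A fun x hx y hy => by
      obtain ⟨g, rfl⟩ := hA x hx
      obtain ⟨h, rfl⟩ := hA y hy
      refine ⟨h * g⁻¹, (h * g⁻¹).2, fun i => ?_⟩
      exact congrArg h.1 (g.1.symm_apply_apply i)
    obtain ⟨φ, hφ, g, hg, hgφ⟩ := hB fun b => c b
    refine ⟨⟨g, hg⟩, fun x hx y hy => ?_⟩
    have key : ∀ x : A, (⟨g, hg⟩ : G) • x.1 = (φ x).1 := fun x => funext fun i => hgφ (x, i)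
    rw [key ⟨x, hx⟩, key ⟨y, hy⟩]
    exact hφ ⟨x, hx⟩ ⟨y, hy⟩

theorem mem_EA_iff (F : Closeds SInfty) :
    F ∈ EA.{u} ↔ IsSubgroupLike (F : Set SInfty) ∧ Ramsey (F : Set SInfty) := by
  rw [isSubgroupLike_iff]
  constructor
  · rintro ⟨G, hG, h⟩
    exact ⟨⟨G, hG⟩, hG ▸ (extremelyAmenable_iff_ramsey G).1 h⟩
  · rintro ⟨⟨G, hG⟩, h⟩
    exact ⟨G, hG, (extremelyAmenable_iff_ramsey G).2 (hG ▸ h)⟩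

end SInfty

theorem mainTheorem8 : MeasurableSet EA.{u} := by
  have : EA.{u} = {F : Closeds SInfty | SInfty.IsSubgroupLike (F : Set SInfty) ∧ SInfty.Ramsey (F : Set SInfty)} :=
    Set.ext SInfty.mem_EA_iff
  rw [this]
  exact (SInfty.measurable_isSubgroupLike.and SInfty.measurable_ramsey).setOf
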